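/- Let $\alpha=(\alpha_n)_{n\ge 1}$ be a positive, strictly increasing sequence tending to infinity, and let $(s_k)_{k\ge1}\subset(1,\infty)$ be any strictly increasing sequence tending to infinity. Put $v_k(n):=s_k^{-\alpha_n}$ and let $c_0(v_k)$ be the space of all $x\in\mathbb C^{\mathbb N}$ with $v_k(n)|x_n|\to0$, normed by $\sup_n v_k(n)|x_n|$. Let $E_\alpha:=\operatorname{ind}_k c_0(v_k)$, that is, $E_\alpha=\bigcup_k c_0(v_k)$ with the finest locally convex topology for which every inclusion $c_0(v_k)\hookrightarrow E_\alpha$ is continuous (this topology is Hausdorff). Let $\mathsf C\in\mathcal L(E_\alpha)$ be the Cesàro operator, $\mathsf Cx=\bigl(\tfrac1n\sum_{i=1}^n x_i\bigr)_{n\ge1}$, where $\mathcal L(E_\alpha)$ is the algebra of continuous linear operators on $E_\alpha$. Then the following conditions are equivalent. 1. $E_\alpha$ is nuclear: for every continuous seminorm $p$ on $E_\alpha$ there is a continuous seminorm $q\ge p$ such that the canonical map $E_q\to E_p$ between the local Banach spaces (the Hausdorff completions of $(E_\alpha,q)$ and $(E_\alpha,p)$) is a nuclear operator. 2. $\displaystyle\sup_{n\in\mathbb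 N}\frac{\log n}{\alpha_n}<\infty$. 3. $\mathsf C$ is invertible in $\mathcal L(E_\alpha)$, i.e. $0\in\rho(\mathsf C;E_\alpha)$, where $\rho(\mathsf C;E_\alpha)$ is the set of all $\lambda\in\mathbb C$ for which $\lambda I-\mathsf C$ has an inverse in $\mathcal L(E_\alpha)$. -/

import Mathlib

open Filter Topology

noncomputable section

/-! ### Nuclear maps and nuclear locally convex spaces -/

/-- A continuous linear map `T : X → Y` between normed spaces is *nuclear* if it has a
representation `T x = ∑ₙ fₙ(x) yₙ` with `fₙ ∈ X'`, `yₙ ∈ Y` and `∑ₙ ‖fₙ‖ ‖yₙ‖ < ∞`. -/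
def IsNuclearMap {X Y : Type*} [NormedAddCommGroup X] [NormedSpace ℂ X]
    [NormedAddCommGroup Y] [NormedSpace ℂ Y] (T : X →L[ℂ] Y) : Prop :=
  ∃ (f : ℕ → X →L[ℂ] ℂ) (y : ℕ → Y),
    Summable (fun n => ‖f n‖ * ‖y n‖) ∧ ∀ x : X, HasSum (fun n => f n x • y n) (T x)

/-- The vector space `E`, regarded as a seminormed space with the seminorm `p`. -/
def SeminormedBy {E : Type*} [AddCommGroup E] [Module ℂ E] (_p : Seminorm ℂ E) : Type _ := E

namespace SeminormedBy

variable {E : Type*} [AddCommGroup E] [Module ℂ E] (p : Seminorm ℂ E)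

instance : SeminormedAddCommGroup (SeminormedBy p) :=
  p.toAddGroupSeminorm.toSeminormedAddCommGroup

instance : Module ℂ (SeminormedBy p) := inferInstanceAs (Module ℂ E)

theorem norm_def (x : SeminormedBy p) : ‖x‖ = p (x : E) := rfl

instance : NormedSpace ℂ (SeminormedBy p) where
  norm_smul_le c x := (map_smul_eq_mul p c (x : E)).le

/-- The identity `(E, q) → (E, p)` for seminorms `p ≤ q`. -/
def idMap {p q : Seminorm ℂ E} (h : p ≤ q) : SeminormedBy q →L[ℂ] SeminormedBy p :=
  LinearMap.mkContinuous
    { toFun := fun x => (x : E)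
      map_add' := fun _ _ => rfl
      map_smul' := fun _ _ => rfl } 1
    (fun x => by rw [one_mul]; exact h (x : E))

end SeminormedBy

/-- The local Banach space `E_p` of a seminorm `p` on `E`: the (Hausdorff) completion of `(E, p)`,
that is, the completion of `E / ker p` with the norm induced by `p`. -/
abbrev LocalBanachSpace {E : Type*} [AddCommGroup E] [Module ℂ E] (p : Seminorm ℂ E) : Type _ :=
  UniformSpace.Completion (SeminormedBy p)

/-- The canonical linking map `E_q → E_p` between local Banach spaces, for seminorms `p ≤ q`. -/
def linkingMap {E : Type*} [AddCommGroup E] [Module ℂ E] {p q : Seminorm ℂ E} (h : p ≤ q) :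
    LocalBanachSpace q →L[ℂ] LocalBanachSpace p :=
  (SeminormedBy.idMap h).completion

/-- A locally convex space `E` is *nuclear* if for every continuous seminorm `p` there is a
continuous seminorm `q ≥ p` such that the linking map `E_q → E_p` is nuclear. -/
def IsNuclearSpace (E : Type*) [AddCommGroup E] [Module ℂ E] [TopologicalSpace E] : Prop :=
  ∀ p : Seminorm ℂ E, Continuous p →
    ∃ (q : Seminorm ℂ E) (h : p ≤ q), Continuous q ∧ IsNuclearMap (linkingMap h)

/-! ### Weighted spaces of null sequences -/

/-- The linear subspace of `ℂ^ℕ` of all sequences `x` with `v(n) x(n) → 0`. -/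
def c0Submodule (v : ℕ → ℝ) : Submodule ℂ (ℕ → ℂ) where
  carrier := {x | Tendsto (fun n => v n • x n) atTop (𝓝 0)}
  zero_mem' := by simp
  add_mem' := by
    intro x y hx hy
    have := Tendsto.add hx hy
    simpa [mul_add] using this
  smul_mem' := by
    intro c x hx
    have := Tendsto.const_smul hx c
    simpa [mul_left_comm c] using this

/-- The weighted space `c₀(v)` (for a positive weight `v`). -/
def WeightedC0 (v : ℕ → ℝ) : Type := c0Submodule v

namespace WeightedC0

variable (v : ℕ → ℝ)

instance : AddCommGroup (WeightedC0 v) := inferInstanceAs (AddCommGroup (c0Submodule v))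

instance : Module ℂ (WeightedC0 v) := inferInstanceAs (Module ℂ (c0Submodule v))

/-- The inclusion of `c₀(v)` into the space of all sequences. -/
def toSeq : WeightedC0 v →ₗ[ℂ] (ℕ → ℂ) := (c0Submodule v).subtype

theorem bddAbove (x : WeightedC0 v) : BddAbove (Set.range fun n => ‖v n • toSeq v x n‖) :=
  (Tendsto.norm x.2).bddAbove_range

/-- The norm `x ↦ supₙ v(n) |x(n)|` of `c₀(v)`. -/
def supSeminorm : Seminorm ℂ (WeightedC0 v) :=
  Seminorm.of (fun x => ⨆ n, ‖v n • toSeq v x n‖)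
    (fun x y => by
      refine ciSup_le fun n => ?_
      calc ‖v n • toSeq v (x + y) n‖ = ‖v n • toSeq v x n + v n • toSeq v y n‖ := by
            rw [map_add, Pi.add_apply, smul_add]
        _ ≤ ‖v n • toSeq v x n‖ + ‖v n • toSeq v y n‖ := norm_add_le _ _
        _ ≤ _ := add_le_add (le_ciSup (bddAbove v x) n) (le_ciSup (bddAbove v y) n))
    (fun c x => by
      rw [Real.mul_iSup_of_nonneg (norm_nonneg c)]
      refine iSup_congr fun n => ?_
      rw [map_smul, Pi.smul_apply, smul_comm, norm_smul])

instance : SeminormedAddCommGroup (WeightedC0 v) :=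
  (supSeminorm v).toAddGroupSeminorm.toSeminormedAddCommGroup

theorem norm_def (x : WeightedC0 v) : ‖x‖ = ⨆ n, ‖v n • toSeq v x n‖ := rfl

instance : NormedSpace ℂ (WeightedC0 v) where
  norm_smul_le c x := (map_smul_eq_mul (supSeminorm v) c x).le

end WeightedC0

/-! ### The co-echelon space `E_α` -/

/-- `α = (αₙ)` is positive, strictly increasing and tends to infinity.
Sequences are indexed from `0` here, so that `α n` is the term `α_{n+1}` in the usual notation. -/
structure IsExponentSeq (α : ℕ → ℝ) : Prop where
  pos : ∀ n, 0 < α n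
  strictMono : StrictMono α
  tendsto : Tendsto α atTop atTop

/-- `s = (s_k)` is a strictly increasing sequence in `(1, ∞)` that tends to infinity. -/
structure IsBaseSeq (s : ℕ → ℝ) : Prop where
  one_lt : ∀ k, 1 < s k
  strictMono : StrictMono s
  tendsto : Tendsto s atTop atTop

/-- The weights `v_k(n) = s_k ^ (-αₙ)`. -/
def weight (α s : ℕ → ℝ) (k n : ℕ) : ℝ := s k ^ (-α n)

/-- The linear subspace of `ℂ^ℕ` generated by the spaces `c₀(v_k)`; it is their union, see
`mem_coEchelonSubmodule_iff`. -/
def coEchelonSubmodule (α s : ℕ → ℝ) : Submodule ℂ (ℕ → ℂ) :=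
  ⨆ k, c0Submodule (weight α s k)

/-- The space `E_α = ind_k c₀(v_k)`. -/
def CoEchelon (α s : ℕ → ℝ) : Type := coEchelonSubmodule α s

namespace CoEchelon

variable (α s : ℕ → ℝ)

instance : AddCommGroup (CoEchelon α s) := inferInstanceAs (AddCommGroup (coEchelonSubmodule α s))

instance : Module ℂ (CoEchelon α s) := inferInstanceAs (Module ℂ (coEchelonSubmodule α s))

/-- The inclusion of `E_α` into the space of all sequences. -/
def toSeq : CoEchelon α s →ₗ[ℂ] (ℕ → ℂ) := (coEchelonSubmodule α s).subtype

/-- The inclusion `c₀(v_k) → E_α`. -/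
def incl (k : ℕ) : WeightedC0 (weight α s k) →ₗ[ℂ] CoEchelon α s :=
  Submodule.inclusion (le_iSup (fun k => c0Submodule (weight α s k)) k)

/-- The locally convex vector space topologies on `E_α` for which all inclusions
`c₀(v_k) → E_α` are continuous. -/
def admissibleTopologies : Set (TopologicalSpace (CoEchelon α s)) :=
  {t | @IsTopologicalAddGroup _ t _ ∧ @ContinuousSMul ℂ _ _ _ t ∧
    @LocallyConvexSpace ℝ _ _ _ _ _ t ∧ ∀ k, @Continuous _ _ _ t (incl α s k)}

/-- The locally convex inductive limit topology: the finest locally convex topology on `E_α` for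
which all inclusions `c₀(v_k) → E_α` are continuous. (In Mathlib's order on topologies, finer is
smaller. The topology is Hausdorff, see `t2Space`, and it belongs to `admissibleTopologies`.) -/
instance : TopologicalSpace (CoEchelon α s) := sInf (admissibleTopologies α s)

instance : IsTopologicalAddGroup (CoEchelon α s) :=
  topologicalAddGroup_sInf fun _ ht => ht.1

instance : ContinuousSMul ℂ (CoEchelon α s) :=
  continuousSMul_sInf fun _ ht => ht.2.1

instance : LocallyConvexSpace ℝ (CoEchelon α s) :=
  LocallyConvexSpace.sInf fun _ ht => ht.2.2.1

theorem continuous_incl (k : ℕ) : Continuous (incl α s k) :=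
  continuous_sInf_rng.2 fun _ ht => ht.2.2.2 k

/-- A linear map from `E_α` to a locally convex space is continuous if all its restrictions to
the steps `c₀(v_k)` are. -/
theorem continuous_of_comp_incl {α s} {F : Type*} [AddCommGroup F] [Module ℂ F]
    [TopologicalSpace F] [IsTopologicalAddGroup F] [ContinuousSMul ℂ F] [LocallyConvexSpace ℝ F]
    (T : CoEchelon α s →ₗ[ℂ] F) (hT : ∀ k, Continuous fun x => T (incl α s k x)) :
    Continuous T := by
  rw [continuous_iff_le_induced]
  refine sInf_le ⟨topologicalAddGroup_induced T, continuousSMul_induced T, ?_, fun k => ?_⟩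
  · exact LocallyConvexSpace.induced (T.restrictScalars ℝ)
  · exact continuous_induced_rng.2 (hT k)

end CoEchelon

theorem weight_pos {α s : ℕ → ℝ} (hs : IsBaseSeq s) (k n : ℕ) : 0 < weight α s k n :=
  Real.rpow_pos_of_pos (zero_lt_one.trans (hs.one_lt k)) _

theorem weight_antitone {α s : ℕ → ℝ} (hα : IsExponentSeq α) (hs : IsBaseSeq s) (k : ℕ) :
    Antitone (weight α s k) := fun _ _ h =>
  Real.rpow_le_rpow_of_exponent_le (hs.one_lt k).le (neg_le_neg (hα.strictMono.monotone h))

theorem weight_le_weight {α s : ℕ → ℝ} (hα : IsExponentSeq α) (hs : IsBaseSeq s) {k l : ℕ}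
    (h : k ≤ l) (n : ℕ) : weight α s l n ≤ weight α s k n :=
  Real.rpow_le_rpow_of_nonpos (zero_lt_one.trans (hs.one_lt k)) (hs.strictMono.monotone h)
    (neg_nonpos.2 (hα.pos n).le)

theorem c0Submodule_mono {v w : ℕ → ℝ} (hw : ∀ n, 0 < w n) (h : ∀ n, w n ≤ v n) :
    c0Submodule v ≤ c0Submodule w := by
  intro x hx
  refine squeeze_zero_norm (fun n => ?_) (tendsto_zero_iff_norm_tendsto_zero.1 hx)
  rw [norm_smul, norm_smul, Real.norm_of_nonneg (hw n).le,
    Real.norm_of_nonneg ((hw n).le.trans (h n))]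
  gcongr
  exact h n

/-- `E_α` is the union of the spaces `c₀(v_k)`. -/
theorem mem_coEchelonSubmodule_iff {α s : ℕ → ℝ} (hα : IsExponentSeq α) (hs : IsBaseSeq s)
    (x : ℕ → ℂ) :
    x ∈ coEchelonSubmodule α s ↔
      ∃ k, Tendsto (fun n => weight α s k n * ‖x n‖) atTop (𝓝 0) := by
  have hmono : Monotone fun k => c0Submodule (weight α s k) := fun k l h =>
    c0Submodule_mono (weight_pos hs l) (weight_le_weight hα hs h)
  rw [coEchelonSubmodule, Submodule.mem_iSup_of_directed _ hmono.directed_le]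
  refine exists_congr fun k => ?_
  refine Iff.trans tendsto_zero_iff_norm_tendsto_zero (iff_of_eq ?_)
  congr 1
  funext n
  rw [norm_smul, Real.norm_of_nonneg (weight_pos hs k n).le]

/-- The topology of `E_α` is Hausdorff. -/
theorem CoEchelon.t2Space {α s : ℕ → ℝ} (hs : IsBaseSeq s) : T2Space (CoEchelon α s) := by
  refine T2Space.of_injective_continuous (f := CoEchelon.toSeq α s) Subtype.val_injective ?_
  refine continuous_of_comp_incl _ fun k => continuous_pi fun n => ?_
  refine AddMonoidHomClass.continuous_of_bound
    ((LinearMap.proj n).comp (WeightedC0.toSeq (weight α s k))) (weight α s k n)⁻¹ fun x => ?_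
  rw [← div_eq_inv_mul, le_div_iff₀ (weight_pos hs k n), mul_comm, WeightedC0.norm_def]
  refine le_trans (le_of_eq ?_) (le_ciSup (WeightedC0.bddAbove _ x) n)
  rw [norm_smul, Real.norm_of_nonneg (weight_pos hs k n).le]
  rfl

/-! ### The Cesàro operator -/

/-- The Cesàro operator on the space of all sequences,
`(C x)ₙ = (x₀ + ⋯ + xₙ) / (n + 1)`. -/
def cesaroSeq : (ℕ → ℂ) →ₗ[ℂ] (ℕ → ℂ) where
  toFun x n := (∑ i ∈ Finset.range (n + 1), x i) / (n + 1)
  map_add' x y := by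
    funext n
    simp [Finset.sum_add_distrib, add_div]
  map_smul' c x := by
    funext n
    simp [← Finset.mul_sum, mul_div_assoc]

theorem norm_weight_smul_cesaroSeq_le {v : ℕ → ℝ} (hv : ∀ n, 0 < v n) (hanti : Antitone v)
    (x : ℕ → ℂ) (n : ℕ) :
    ‖v n • cesaroSeq x n‖ ≤
      ((n + 1 : ℕ) : ℝ)⁻¹ * ∑ i ∈ Finset.range (n + 1), ‖v i • x i‖ := by
  have h1 : ‖(n + 1 : ℂ)‖ = ((n + 1 : ℕ) : ℝ) := by
    rw [← Nat.cast_succ, Complex.norm_natCast]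
  have h2 : ‖v n • cesaroSeq x n‖ =
      ((n + 1 : ℕ) : ℝ)⁻¹ * (v n * ‖∑ i ∈ Finset.range (n + 1), x i‖) := by
    change ‖v n • ((∑ i ∈ Finset.range (n + 1), x i) / (n + 1 : ℂ))‖ = _
    rw [norm_smul, norm_div, h1, Real.norm_of_nonneg (hv n).le]
    ring
  rw [h2]
  refine mul_le_mul_of_nonneg_left ?_ (by positivity)
  refine (mul_le_mul_of_nonneg_left (norm_sum_le _ _) (hv n).le).trans ?_
  rw [Finset.mul_sum]
  refine Finset.sum_le_sum fun i hi => ?_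
  rw [norm_smul, Real.norm_of_nonneg (hv i).le]
  exact mul_le_mul_of_nonneg_right (hanti (Nat.lt_succ_iff.1 (Finset.mem_range.1 hi)))
    (norm_nonneg _)

theorem cesaroSeq_mem_c0Submodule {v : ℕ → ℝ} (hv : ∀ n, 0 < v n) (hanti : Antitone v)
    {x : ℕ → ℂ} (hx : x ∈ c0Submodule v) : cesaroSeq x ∈ c0Submodule v := by
  have h0 : Tendsto (fun n => ‖v n • x n‖) atTop (𝓝 0) :=
    tendsto_zero_iff_norm_tendsto_zero.1 hx
  exact squeeze_zero_norm (norm_weight_smul_cesaroSeq_le hv hanti x)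
    (h0.cesaro.comp (tendsto_add_atTop_nat 1))

theorem cesaroSeq_mem_coEchelonSubmodule {α s : ℕ → ℝ} (hα : IsExponentSeq α) (hs : IsBaseSeq s)
    (x : ℕ → ℂ) (hx : x ∈ coEchelonSubmodule α s) : cesaroSeq x ∈ coEchelonSubmodule α s := by
  have h : coEchelonSubmodule α s ≤ (coEchelonSubmodule α s).comap cesaroSeq :=
    iSup_le fun k _ hy => Submodule.mem_iSup_of_mem k
      (cesaroSeq_mem_c0Submodule (weight_pos hs k) (weight_antitone hα hs k) hy)
  exact h hx

/-- The restriction of the Cesàro operator to `E_α`, as a linear map. -/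
def cesaroLinear {α s : ℕ → ℝ} (hα : IsExponentSeq α) (hs : IsBaseSeq s) :
    CoEchelon α s →ₗ[ℂ] CoEchelon α s :=
  cesaroSeq.restrict (cesaroSeq_mem_coEchelonSubmodule hα hs)

/-- The Cesàro operator as an element of `L(E_α)`, the algebra of continuous linear operators
on `E_α`. -/
def cesaro {α s : ℕ → ℝ} (hα : IsExponentSeq α) (hs : IsBaseSeq s) :
    CoEchelon α s →L[ℂ] CoEchelon α s where
  toLinearMap := cesaroLinear hα hs
  cont := by
    refine CoEchelon.continuous_of_comp_incl (cesaroLinear hα hs) fun k => ?_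
    let S : WeightedC0 (weight α s k) →ₗ[ℂ] WeightedC0 (weight α s k) :=
      cesaroSeq.restrict fun _ hx =>
        cesaroSeq_mem_c0Submodule (weight_pos hs k) (weight_antitone hα hs k) hx
    have hS : Continuous S := by
      refine AddMonoidHomClass.continuous_of_bound S 1 fun x => ?_
      rw [one_mul, WeightedC0.norm_def]
      refine ciSup_le fun n => ?_
      refine (norm_weight_smul_cesaroSeq_le (weight_pos hs k) (weight_antitone hα hs k)
        (WeightedC0.toSeq _ x) n).trans ?_
      rw [inv_mul_le_iff₀ (by positivity), ← nsmul_eq_mul]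
      refine (Finset.sum_le_card_nsmul _ _ ‖x‖ fun i _ => ?_).trans (by rw [Finset.card_range])
      exact le_ciSup (WeightedC0.bddAbove _ x) i
    exact (CoEchelon.continuous_incl α s k).comp hS

theorem toSeq_cesaro {α s : ℕ → ℝ} (hα : IsExponentSeq α) (hs : IsBaseSeq s) (x : CoEchelon α s)
    (n : ℕ) :
    CoEchelon.toSeq α s (cesaro hα hs x) n =
      (∑ i ∈ Finset.range (n + 1), CoEchelon.toSeq α s x i) / (n + 1) := rfl

end

/-! The growth condition log(n+1) ≤ M αₙ is exactly what lets powers of n be absorbed by a change of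
step: if s_l ≥ s_k e^{jM}, then (n+1)^j v_l(n) ≤ v_k(n) (`exists_pow_mul_weight_le`). With j = 2 the
expansion x = ∑ xₙ eₙ becomes absolutely summable for every continuous seminorm, which gives
nuclearity. With j = 1 the unbounded factor in the inverse (n+1)xₙ - n xₙ₋₁ of the Cesàro operator
is absorbed, so the inverse maps each step continuously into a later one.

Conversely, if E_α is nuclear, a trace estimate shows that every weight dominated by all v_k is
summable (`exists_sum_le_of_isNuclearSpace`). Were tₙ = log(n+1)/αₙ unbounded, with running maximum
Tₙ, then exp(-Tₙαₙ/2) would be such a weight. Since it decreases, its summability yields tₙ ≤ const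
+ Tₙ/2, which fails at large record values of t. If the Cesàro operator is onto, the preimage of
((-1)ⁿ) has modulus 2n+1; its membership in a single c₀(v_k) forces the growth condition. -/

noncomputable section

/-! ### Local Banach spaces -/

namespace LocalBanachSpace

variable {E : Type*} [AddCommGroup E] [Module ℂ E]

/-- The canonical map from `E` to its local Banach space `E_p`. -/
def of (p : Seminorm ℂ E) : E →ₗ[ℂ] LocalBanachSpace p :=
  (UniformSpace.Completion.toComplₗᵢ (𝕜 := ℂ) (E := SeminormedBy p)).toLinearMap

theorem norm_of (p : Seminorm ℂ E) (x : E) : ‖of p x‖ = p x :=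
  UniformSpace.Completion.norm_coe (E := SeminormedBy p) x

theorem denseRange_of (p : Seminorm ℂ E) : DenseRange (of p) :=
  UniformSpace.Completion.denseRange_coe (α := SeminormedBy p)

theorem linkingMap_of {p q : Seminorm ℂ E} (h : p ≤ q) (x : E) :
    linkingMap h (of q x) = of p x :=
  ContinuousLinearMap.completion_apply_coe (SeminormedBy.idMap h) x

/-- A linear functional bounded by a multiple of `p` extends to the local Banach space `E_p`. -/
theorem exists_functional (p : Seminorm ℂ E) (φ : E →ₗ[ℂ] ℂ) {C : ℝ} (hC : 0 ≤ C)
    (h : ∀ x, ‖φ x‖ ≤ C * p x) :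
    ∃ f : LocalBanachSpace p →L[ℂ] ℂ, ‖f‖ ≤ C ∧ ∀ x, f (of p x) = φ x := by
  have h' : ∀ x, ‖φ x‖ ≤ C * ‖of p x‖ := fun x => by rw [norm_of]; exact h x
  exact ⟨φ.extendOfNorm (of p), LinearMap.opNorm_extendOfNorm_le (denseRange_of p) hC h',
    fun x => LinearMap.extendOfNorm_eq (denseRange_of p) ⟨C, h'⟩ x⟩

end LocalBanachSpace

/-- A continuous linear map is nuclear if it has a nuclear expansion on a dense subset. -/
theorem IsNuclearMap.of_dense {X Y : Type*} [NormedAddCommGroup X] [NormedSpace ℂ X]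
    [NormedAddCommGroup Y] [NormedSpace ℂ Y] [CompleteSpace Y] (T : X →L[ℂ] Y)
    (f : ℕ → X →L[ℂ] ℂ) (y : ℕ → Y) (hfy : Summable fun n => ‖f n‖ * ‖y n‖)
    {D : Set X} (hD : Dense D)
    (h : ∀ x ∈ D, Tendsto (fun N => ∑ n ∈ Finset.range N, f n x • y n) atTop (𝓝 (T x))) :
    IsNuclearMap T := by
  -- The rank-one operators are absolutely summable in operator norm, so their sum is continuous and
  -- need only agree with `T` on `D`.
  obtain ⟨S, hS⟩ : Summable fun n => (f n).smulRight (y n) :=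
    Summable.of_norm (by simpa only [ContinuousLinearMap.norm_smulRight_apply] using hfy)
  have happ : ∀ x, HasSum (fun n => f n x • y n) (S x) := fun x =>
    hS.mapL (ContinuousLinearMap.apply ℂ Y x)
  have hT : ∀ x, S x = T x := congrFun <| Continuous.ext_on hD S.continuous T.continuous
    fun x hx => tendsto_nhds_unique (happ x).tendsto_sum_nat (h x hx)
  exact ⟨f, y, hfy, fun x => hT x ▸ happ x⟩

/-! ### Weighted spaces of null sequences -/

namespace WeightedC0

variable {v : ℕ → ℝ}

theorem norm_apply_le (hv : ∀ n, 0 < v n) (x : WeightedC0 v) (n : ℕ) :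
    v n * ‖toSeq v x n‖ ≤ ‖x‖ := by
  refine le_trans (le_of_eq ?_) (le_ciSup (bddAbove v x) n)
  rw [norm_smul, Real.norm_of_nonneg (hv n).le]

theorem norm_le (hv : ∀ n, 0 < v n) (x : WeightedC0 v) {c : ℝ}
    (h : ∀ n, v n * ‖toSeq v x n‖ ≤ c) : ‖x‖ ≤ c := by
  rw [norm_def]
  refine ciSup_le fun n => ?_
  rw [norm_smul, Real.norm_of_nonneg (hv n).le]
  exact h n

theorem tendsto_apply (hv : ∀ n, 0 < v n) (x : WeightedC0 v) :
    Tendsto (fun n => v n * ‖toSeq v x n‖) atTop (𝓝 0) := by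
  refine (tendsto_zero_iff_norm_tendsto_zero.1 x.2).congr fun n => ?_
  rw [norm_smul, Real.norm_of_nonneg (hv n).le]
  rfl

theorem single_mem (v : ℕ → ℝ) (n : ℕ) : (Pi.single n 1 : ℕ → ℂ) ∈ c0Submodule v := by
  refine tendsto_const_nhds.congr' ?_
  filter_upwards [eventually_gt_atTop n] with m hm
  simp [Pi.single_eq_of_ne hm.ne']

/-- The unit vectors of `c₀(v)`. -/
def single (v : ℕ → ℝ) (n : ℕ) : WeightedC0 v := (⟨Pi.single n 1, single_mem v n⟩ : c0Submodule v)

theorem toSeq_single (n : ℕ) : toSeq v (single v n) = Pi.single n 1 := rfl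

theorem toSeq_sum_single (c : ℕ → ℂ) (N m : ℕ) :
    toSeq v (∑ n ∈ Finset.range N, c n • single v n) m = if m < N then c m else 0 := by
  simp [toSeq_single, Finset.sum_apply, Pi.single_apply]

/-- Every element of `c₀(v)` is the limit of its truncations. -/
theorem tendsto_norm_sub_truncation (hv : ∀ n, 0 < v n) (x : WeightedC0 v) :
    Tendsto (fun N => ‖x - ∑ n ∈ Finset.range N, toSeq v x n • single v n‖) atTop (𝓝 0) := by
  rw [Metric.tendsto_atTop]
  intro ε hε
  obtain ⟨N₀, hN₀⟩ := Metric.tendsto_atTop.1 (tendsto_apply hv x) (ε / 2) (half_pos hε)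
  refine ⟨N₀, fun N hN => ?_⟩
  rw [dist_zero_right, norm_norm]
  refine (norm_le hv _ (c := ε / 2) fun m => ?_).trans_lt (half_lt_self hε)
  rw [map_sub, Pi.sub_apply, toSeq_sum_single]
  split_ifs with hm
  · simpa using (half_pos hε).le
  · have := hN₀ m (hN.trans (not_lt.1 hm))
    rw [dist_zero_right, Real.norm_eq_abs] at this
    rw [sub_zero]
    exact (le_abs_self _).trans this.le

end WeightedC0

/-! ### Continuous seminorms on `E_α` -/

namespace CoEchelon

variable {α s : ℕ → ℝ}

theorem toSeq_injective : Function.Injective (toSeq α s) := Subtype.val_injective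

theorem toSeq_incl (k : ℕ) (x : WeightedC0 (weight α s k)) :
    toSeq α s (incl α s k x) = WeightedC0.toSeq _ x := rfl

theorem exists_incl_eq (hα : IsExponentSeq α) (hs : IsBaseSeq s) (x : CoEchelon α s) :
    ∃ k y, incl α s k y = x := by
  have hmono : Monotone fun k => c0Submodule (weight α s k) := fun k l h =>
    c0Submodule_mono (weight_pos hs l) (weight_le_weight hα hs h)
  obtain ⟨k, hk⟩ := (Submodule.mem_iSup_of_directed _ hmono.directed_le).1 x.2
  exact ⟨k, (⟨x.1, hk⟩ : c0Submodule (weight α s k)), Subtype.ext rfl⟩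

/-- `p` is the norm composed with the identity from E_α to `SeminormedBy p`, so the universal
property of the inductive limit for linear maps applies. -/
theorem continuous_seminorm (p : Seminorm ℂ (CoEchelon α s))
    (h : ∀ k, ∃ C, ∀ x, p (incl α s k x) ≤ C * ‖x‖) : Continuous p := by
  let T : CoEchelon α s →ₗ[ℂ] SeminormedBy p :=
    { toFun := fun x => x
      map_add' := fun _ _ => rfl
      map_smul' := fun _ _ => rfl }
  have hT : Continuous T := by
    refine continuous_of_comp_incl T fun k => ?_
    obtain ⟨C, hC⟩ := h k
    exact AddMonoidHomClass.continuous_of_bound (T.comp (incl α s k)) C hC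
  exact continuous_norm.comp hT

theorem exists_seminorm_incl_le {p : Seminorm ℂ (CoEchelon α s)} (hp : Continuous p) (k : ℕ) :
    ∃ C, 0 < C ∧ ∀ x, p (incl α s k x) ≤ C * ‖x‖ :=
  Seminorm.bound_of_continuous_normedSpace (p.comp (incl α s k))
    (hp.comp (continuous_incl α s k))

/-- The unit vectors of `E_α`. -/
def single (α s : ℕ → ℝ) (n : ℕ) : CoEchelon α s := incl α s 0 (WeightedC0.single _ n)

theorem incl_single (k n : ℕ) : incl α s k (WeightedC0.single _ n) = single α s n :=
  toSeq_injective rfl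

theorem toSeq_single (n : ℕ) : toSeq α s (single α s n) = Pi.single n 1 := rfl

theorem seminorm_single_le (hs : IsBaseSeq s) {p : Seminorm ℂ (CoEchelon α s)} {k : ℕ} {C : ℝ}
    (hC : 0 ≤ C) (h : ∀ x, p (incl α s k x) ≤ C * ‖x‖) (n : ℕ) :
    p (single α s n) ≤ C * weight α s k n := by
  rw [← incl_single k]
  refine (h _).trans (mul_le_mul_of_nonneg_left ?_ hC)
  refine WeightedC0.norm_le (weight_pos hs k) _ fun m => ?_
  rw [WeightedC0.toSeq_single, Pi.single_apply]
  split_ifs with hm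
  · simp [hm]
  · simp [(weight_pos hs k n).le]

/-- Each `x` lives in a single step, where truncations converge in norm because weighted entries
tend to zero; continuity of `p` on that step transfers the limit. -/
theorem tendsto_seminorm_sub_truncation (hα : IsExponentSeq α) (hs : IsBaseSeq s)
    {p : Seminorm ℂ (CoEchelon α s)} (hp : Continuous p) (x : CoEchelon α s) :
    Tendsto (fun N => p (x - ∑ n ∈ Finset.range N, toSeq α s x n • single α s n))
      atTop (𝓝 0) := by
  obtain ⟨k, y, rfl⟩ := exists_incl_eq hα hs x
  have h := (hp.comp (continuous_incl α s k)).tendsto 0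
  rw [Function.comp_apply, map_zero, map_zero] at h
  have h' := h.comp
    (tendsto_zero_iff_norm_tendsto_zero.2
      (WeightedC0.tendsto_norm_sub_truncation (weight_pos hs k) y))
  refine h'.congr fun N => ?_
  simp only [Function.comp_apply, map_sub, map_sum, map_smul, incl_single, toSeq_incl]

/-- A weight `a` that is dominated by every `v_k`, so that `x ↦ supₙ a(n) |x(n)|` is a continuous
seminorm on `E_α`. -/
structure IsDominated (α s a : ℕ → ℝ) : Prop where
  nonneg : ∀ n, 0 ≤ a n
  le : ∀ k, ∃ C, 0 ≤ C ∧ ∀ n, a n ≤ C * weight α s k n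

namespace IsDominated

variable {a : ℕ → ℝ}

theorem exists_le (ha : IsDominated α s a) (hs : IsBaseSeq s) (k : ℕ) :
    ∃ C, 0 ≤ C ∧ ∀ (x : WeightedC0 (weight α s k)) n,
      a n * ‖toSeq α s (incl α s k x) n‖ ≤ C * ‖x‖ := by
  obtain ⟨C, hC, h⟩ := ha.le k
  refine ⟨C, hC, fun x n => ?_⟩
  calc a n * ‖toSeq α s (incl α s k x) n‖
      ≤ C * weight α s k n * ‖WeightedC0.toSeq _ x n‖ :=
        mul_le_mul_of_nonneg_right (h n) (norm_nonneg _)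
    _ = C * (weight α s k n * ‖WeightedC0.toSeq _ x n‖) := mul_assoc _ _ _
    _ ≤ C * ‖x‖ :=
        mul_le_mul_of_nonneg_left (WeightedC0.norm_apply_le (weight_pos hs k) x n) hC

theorem bddAbove (ha : IsDominated α s a) (hα : IsExponentSeq α) (hs : IsBaseSeq s)
    (x : CoEchelon α s) : BddAbove (Set.range fun n => a n * ‖toSeq α s x n‖) := by
  obtain ⟨k, y, rfl⟩ := exists_incl_eq hα hs x
  obtain ⟨C, -, h⟩ := ha.exists_le hs k
  exact ⟨C * ‖y‖, by rintro _ ⟨n, rfl⟩; exact h y n⟩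

/-- The seminorm `x ↦ supₙ a(n) |x(n)|` on `E_α`. -/
def seminorm (ha : IsDominated α s a) (hα : IsExponentSeq α) (hs : IsBaseSeq s) :
    Seminorm ℂ (CoEchelon α s) :=
  Seminorm.of (fun x => ⨆ n, a n * ‖toSeq α s x n‖)
    (fun x y => by
      refine ciSup_le fun n => ?_
      calc a n * ‖toSeq α s (x + y) n‖ ≤ a n * ‖toSeq α s x n‖ + a n * ‖toSeq α s y n‖ := by
            rw [map_add, Pi.add_apply, ← mul_add]
            exact mul_le_mul_of_nonneg_left (norm_add_le _ _) (ha.nonneg n)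
        _ ≤ _ := add_le_add (le_ciSup (ha.bddAbove hα hs x) n) (le_ciSup (ha.bddAbove hα hs y) n))
    (fun c x => by
      rw [Real.mul_iSup_of_nonneg (norm_nonneg c)]
      refine iSup_congr fun n => ?_
      rw [map_smul, Pi.smul_apply, norm_smul, mul_left_comm])

theorem le_seminorm (ha : IsDominated α s a) (hα : IsExponentSeq α) (hs : IsBaseSeq s)
    (x : CoEchelon α s) (n : ℕ) : a n * ‖toSeq α s x n‖ ≤ ha.seminorm hα hs x :=
  le_ciSup (ha.bddAbove hα hs x) n

theorem continuous_seminorm (ha : IsDominated α s a) (hα : IsExponentSeq α) (hs : IsBaseSeq s) :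
    Continuous (ha.seminorm hα hs) := by
  refine CoEchelon.continuous_seminorm _ fun k => ?_
  obtain ⟨C, -, h⟩ := ha.exists_le hs k
  exact ⟨C, fun x => ciSup_le fun n => h x n⟩

end IsDominated

end CoEchelon

/-! ### Nuclearity and growth of the exponents -/

namespace CoEchelon

variable {α s : ℕ → ℝ}

/-- Enlarging the base by the factor e^{jM} multiplies the weight by e^{-jMαₙ} ≤ (n+1)^{-j}; since s
is unbounded, some index `l` provides that factor. -/
theorem exists_pow_mul_weight_le (hα : IsExponentSeq α) (hs : IsBaseSeq s)
    (h : BddAbove (Set.range fun n : ℕ => Real.log (n + 1) / α n)) (j k : ℕ) :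
    ∃ l, ∀ n : ℕ, ((n : ℝ) + 1) ^ j * weight α s l n ≤ weight α s k n := by
  obtain ⟨M, hM⟩ := h
  obtain ⟨l, hl⟩ := (hs.tendsto.eventually_ge_atTop (s k * Real.exp (j * M))).exists
  refine ⟨l, fun n => ?_⟩
  have hsk : 0 < s k := zero_lt_one.trans (hs.one_lt k)
  have hlog : Real.log (n + 1) ≤ M * α n := (div_le_iff₀ (hα.pos n)).1 (hM ⟨n, rfl⟩)
  have hn : (n : ℝ) + 1 ≤ Real.exp (M * α n) := (Real.log_le_iff_le_exp (by positivity)).1 hlog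
  have hw : weight α s l n ≤ weight α s k n * Real.exp (j * M) ^ (-α n) := by
    rw [weight, weight, ← Real.mul_rpow hsk.le (Real.exp_pos _).le]
    exact Real.rpow_le_rpow_of_nonpos (by positivity) hl (neg_nonpos.2 (hα.pos n).le)
  calc ((n : ℝ) + 1) ^ j * weight α s l n
      ≤ Real.exp (M * α n) ^ j * (weight α s k n * Real.exp (j * M) ^ (-α n)) :=
        mul_le_mul (pow_le_pow_left₀ (by positivity) hn j) hw (weight_pos hs l n).le
          (by positivity)
    _ = weight α s k n * (Real.exp (j * (M * α n)) * Real.exp (j * M * -α n)) := by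
        rw [← Real.exp_nat_mul, ← Real.exp_mul]; ring
    _ = weight α s k n := by
        rw [← Real.exp_add, show j * (M * α n) + j * M * -α n = 0 by ring, Real.exp_zero, mul_one]

/-- The majorant `q` is the weighted sup seminorm with weight K(n+1)² p(eₙ). The square makes ∑ |xₙ|
p(eₙ) converge with a bound by q(x), and this one estimate gives both p ≤ q and the nuclear
expansion. -/
theorem isNuclearSpace_of_bddAbove (hα : IsExponentSeq α) (hs : IsBaseSeq s)
    (h : BddAbove (Set.range fun n : ℕ => Real.log (n + 1) / α n)) :
    IsNuclearSpace (CoEchelon α s) := by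
  intro p hp
  have hsum : Summable fun n : ℕ => (((n : ℝ) + 1) ^ 2)⁻¹ := by
    simpa using (summable_nat_add_iff 1).2 (Real.summable_nat_pow_inv.2 one_lt_two)
  -- `K` normalises the weight so that p ≤ q holds with constant 1.
  set K : ℝ := ∑' n : ℕ, (((n : ℝ) + 1) ^ 2)⁻¹ with hK
  have hK0 : 0 < K := hsum.tsum_pos (fun n => by positivity) 0 (by positivity)
  set b : ℕ → ℝ := fun n => p (single α s n) with hb
  have hb0 : ∀ n, 0 ≤ b n := fun n => apply_nonneg p _
  have ha : IsDominated α s fun n => K * ((n : ℝ) + 1) ^ 2 * b n := by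
    refine ⟨fun n => by have := hb0 n; positivity, fun k => ?_⟩
    obtain ⟨l, hl⟩ := exists_pow_mul_weight_le hα hs h 2 k
    obtain ⟨C, hC, hpC⟩ := exists_seminorm_incl_le hp l
    refine ⟨K * C, by positivity, fun n => ?_⟩
    calc K * ((n : ℝ) + 1) ^ 2 * b n ≤ K * ((n : ℝ) + 1) ^ 2 * (C * weight α s l n) :=
          mul_le_mul_of_nonneg_left (seminorm_single_le hs hC.le hpC n) (by positivity)
      _ = K * C * (((n : ℝ) + 1) ^ 2 * weight α s l n) := by ring
      _ ≤ K * C * weight α s k n := mul_le_mul_of_nonneg_left (hl n) (by positivity)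
  set q := ha.seminorm hα hs
  have hbq : ∀ x n, b n * ‖toSeq α s x n‖ ≤ K⁻¹ * (((n : ℝ) + 1) ^ 2)⁻¹ * q x := by
    intro x n
    have := ha.le_seminorm hα hs x n
    rw [← mul_inv, inv_mul_eq_div, le_div_iff₀ (by positivity)]
    linarith
  have hpq : p ≤ q := by
    intro x
    have hN : ∀ N, p x ≤
        p (x - ∑ n ∈ Finset.range N, toSeq α s x n • single α s n) + q x := by
      intro N
      have h1 : p (∑ n ∈ Finset.range N, toSeq α s x n • single α s n) ≤ q x := by
        calc p (∑ n ∈ Finset.range N, toSeq α s x n • single α s n)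
            ≤ ∑ n ∈ Finset.range N, p (toSeq α s x n • single α s n) :=
              Finset.le_sum_of_subadditive p (map_zero p).le (map_add_le_add p) _ _
          _ ≤ ∑ n ∈ Finset.range N, K⁻¹ * (((n : ℝ) + 1) ^ 2)⁻¹ * q x := by
              refine Finset.sum_le_sum fun n _ => ?_
              rw [map_smul_eq_mul, mul_comm]
              exact hbq x n
          _ = K⁻¹ * (∑ n ∈ Finset.range N, (((n : ℝ) + 1) ^ 2)⁻¹) * q x := by
              rw [Finset.mul_sum, Finset.sum_mul]
          _ ≤ K⁻¹ * K * q x := by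
              have := hsum.sum_le_tsum (Finset.range N) fun n _ => by positivity
              have := apply_nonneg q x
              gcongr
          _ = q x := by rw [inv_mul_cancel₀ hK0.ne', one_mul]
      have h2 := map_add_le_add p (x - ∑ n ∈ Finset.range N, toSeq α s x n • single α s n)
        (∑ n ∈ Finset.range N, toSeq α s x n • single α s n)
      rw [sub_add_cancel] at h2
      linarith
    have := ((tendsto_seminorm_sub_truncation hα hs hp x).add_const (q x))
    rw [zero_add] at this
    exact ge_of_tendsto' this hN
  refine ⟨q, hpq, ha.continuous_seminorm hα hs, ?_⟩
  have hf : ∀ n : ℕ, ∃ f : LocalBanachSpace q →L[ℂ] ℂ, ‖f‖ ≤ K⁻¹ * (((n : ℝ) + 1) ^ 2)⁻¹ ∧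
      ∀ x, f (LocalBanachSpace.of q x) = (b n : ℂ) * toSeq α s x n := fun n =>
    LocalBanachSpace.exists_functional q ((b n : ℂ) • (LinearMap.proj n).comp (toSeq α s))
      (by positivity) fun x => by
        refine le_trans (le_of_eq ?_) (hbq x n)
        change ‖(b n : ℂ) * toSeq α s x n‖ = _
        rw [norm_mul, Complex.norm_real, Real.norm_of_nonneg (hb0 n)]
  choose f hfn hfx using hf
  -- The factor p(eₙ) sits in `f n`, and the vector is rescaled to norm at most 1. If p(eₙ) = 0 the
  -- inverse is 0 by convention, which is harmless because eₙ then vanishes in E_p.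
  refine IsNuclearMap.of_dense _ f
    (fun n => ((b n)⁻¹ : ℂ) • LocalBanachSpace.of p (single α s n)) ?_
    (LocalBanachSpace.denseRange_of q) ?_
  · refine Summable.of_nonneg_of_le (fun n => by positivity) (fun n => ?_) (hsum.mul_left K⁻¹)
    refine (mul_le_of_le_one_right (norm_nonneg _) ?_).trans (hfn n)
    rw [norm_smul, LocalBanachSpace.norm_of, norm_inv, Complex.norm_real,
      Real.norm_of_nonneg (hb0 n)]
    exact inv_mul_le_one
  · rintro _ ⟨x, rfl⟩
    rw [LocalBanachSpace.linkingMap_of, tendsto_iff_norm_sub_tendsto_zero]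
    refine (tendsto_seminorm_sub_truncation hα hs hp x).congr fun N => ?_
    rw [norm_sub_rev, ← LocalBanachSpace.norm_of p, map_sub, map_sum]
    congr 2
    refine Finset.sum_congr rfl fun n _ => ?_
    rw [hfx, map_smul, smul_smul]
    rcases eq_or_ne (b n) 0 with hn | hn
    · have : LocalBanachSpace.of p (single α s n) = 0 := by
        rw [← norm_eq_zero, LocalBanachSpace.norm_of]
        exact hn
      rw [this, smul_zero, smul_zero]
    · rw [mul_right_comm, mul_inv_cancel₀ (Complex.ofReal_ne_zero.2 hn), one_mul]

/-- The diagonal estimate: in a nuclear space `E_α`, dominated weights are summable. -/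
theorem exists_sum_le_of_isNuclearSpace (hα : IsExponentSeq α) (hs : IsBaseSeq s)
    (h : IsNuclearSpace (CoEchelon α s)) {a : ℕ → ℝ} (ha : IsDominated α s a) :
    ∃ K, ∀ N, ∑ n ∈ Finset.range N, a n ≤ K := by
  set p := ha.seminorm hα hs
  obtain ⟨q, hpq, hq, f, y, hfy, hT⟩ := h p (ha.continuous_seminorm hα hs)
  obtain ⟨D, hD, hqD⟩ := exists_seminorm_incl_le hq 0
  -- These weighted coordinates have norm at most 1 by the choice of `p`; they read off the diagonal
  -- of the linking map.
  have hg : ∀ n, ∃ g : LocalBanachSpace p →L[ℂ] ℂ, ‖g‖ ≤ 1 ∧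
      ∀ x, g (LocalBanachSpace.of p x) = (a n : ℂ) * toSeq α s x n := fun n =>
    LocalBanachSpace.exists_functional p ((a n : ℂ) • (LinearMap.proj n).comp (toSeq α s))
      zero_le_one fun x => by
        rw [one_mul]
        refine le_trans (le_of_eq ?_) (ha.le_seminorm hα hs x n)
        change ‖(a n : ℂ) * toSeq α s x n‖ = _
        rw [norm_mul, Complex.norm_real, Real.norm_of_nonneg (ha.nonneg n)]
  choose g hgn hgx using hg
  -- Unimodular factors make every term nonnegative. Since v₀ ≤ 1, the vector ∑ εₙeₙ has norm at
  -- most 1 in c₀(v₀), so the bound does not depend on `N`.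
  have hsign : ∀ i N, ∑ n ∈ Finset.range N, ‖f i (LocalBanachSpace.of q (single α s n))‖ ≤
      D * ‖f i‖ := by
    intro i N
    choose ε hε hεf using fun n =>
      RCLike.exists_norm_eq_mul_self (f i (LocalBanachSpace.of q (single α s n)))
    have h1 : ((∑ n ∈ Finset.range N, ‖f i (LocalBanachSpace.of q (single α s n))‖ : ℝ) : ℂ) =
        f i (LocalBanachSpace.of q
          (incl α s 0 (∑ n ∈ Finset.range N, ε n • WeightedC0.single _ n))) := by
      simp only [map_sum, map_smul, incl_single, smul_eq_mul, Complex.ofReal_sum]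
      exact Finset.sum_congr rfl fun n _ => hεf n
    have h2 : ‖∑ n ∈ Finset.range N, ε n • WeightedC0.single (weight α s 0) n‖ ≤ 1 := by
      refine WeightedC0.norm_le (weight_pos hs 0) _ fun m => ?_
      rw [WeightedC0.toSeq_sum_single]
      split_ifs
      · rw [hε, mul_one]
        exact Real.rpow_le_one_of_one_le_of_nonpos (hs.one_lt 0).le (neg_nonpos.2 (hα.pos m).le)
      · simp
    calc ∑ n ∈ Finset.range N, ‖f i (LocalBanachSpace.of q (single α s n))‖
        = ‖f i (LocalBanachSpace.of q
          (incl α s 0 (∑ n ∈ Finset.range N, ε n • WeightedC0.single _ n)))‖ := by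
          rw [← h1, Complex.norm_real, Real.norm_of_nonneg (by positivity)]
      _ ≤ ‖f i‖ * (D * 1) := by
          refine ((f i).le_opNorm _).trans (mul_le_mul_of_nonneg_left ?_ (norm_nonneg _))
          rw [LocalBanachSpace.norm_of]
          exact (hqD _).trans (mul_le_mul_of_nonneg_left h2 hD.le)
      _ = D * ‖f i‖ := by ring
  refine ⟨D * ∑' i, ‖f i‖ * ‖y i‖, fun N => ?_⟩
  -- Each aₙ is a diagonal entry of the linking map. Summing over n and exchanging the sums bounds
  -- the partial trace by D ∑ ‖fᵢ‖‖yᵢ‖.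
  have hdiag : ∀ n, HasSum
      (fun i => f i (LocalBanachSpace.of q (single α s n)) * g n (y i)) (a n : ℂ) := by
    intro n
    have := (hT (LocalBanachSpace.of q (single α s n))).mapL (g n)
    simpa [LocalBanachSpace.linkingMap_of, hgx, toSeq_single] using this
  have htot := hasSum_sum fun n (_ : n ∈ Finset.range N) => hdiag n
  have hle := tsum_of_norm_bounded (hfy.hasSum.mul_left D)
    (f := fun i => ∑ n ∈ Finset.range N,
      f i (LocalBanachSpace.of q (single α s n)) * g n (y i)) fun i => by
    calc ‖∑ n ∈ Finset.range N, f i (LocalBanachSpace.of q (single α s n)) * g n (y i)‖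
        ≤ ∑ n ∈ Finset.range N, ‖f i (LocalBanachSpace.of q (single α s n))‖ * ‖y i‖ := by
          refine norm_sum_le_of_le _ fun n _ => ?_
          rw [norm_mul]
          refine mul_le_mul_of_nonneg_left ?_ (norm_nonneg _)
          exact ((g n).le_of_opNorm_le (hgn n) _).trans (one_mul _).le
      _ = (∑ n ∈ Finset.range N, ‖f i (LocalBanachSpace.of q (single α s n))‖) * ‖y i‖ :=
          (Finset.sum_mul _ _ _).symm
      _ ≤ D * ‖f i‖ * ‖y i‖ := mul_le_mul_of_nonneg_right (hsign i N) (norm_nonneg _)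
      _ = D * (‖f i‖ * ‖y i‖) := mul_assoc _ _ _
  rw [htot.tsum_eq, ← Complex.ofReal_sum, Complex.norm_real] at hle
  exact (le_abs_self _).trans hle

/-- The weight lies below v_k(n) = exp(-αₙ log s_k) once r(n) ≥ log s_k; the finitely many remaining
indices only affect the constant. -/
theorem isDominated_exp (hα : IsExponentSeq α) (hs : IsBaseSeq s) {r : ℕ → ℝ}
    (hr : Tendsto r atTop atTop) : IsDominated α s fun n => Real.exp (-(r n * α n)) := by
  refine ⟨fun n => (Real.exp_pos _).le, fun k => ?_⟩
  have hev : ∀ᶠ n in atTop, Real.exp (-(r n * α n)) / weight α s k n ≤ 1 := by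
    filter_upwards [hr.eventually_ge_atTop (Real.log (s k))] with n hn
    rw [div_le_one (weight_pos hs k n), weight,
      Real.rpow_def_of_pos (zero_lt_one.trans (hs.one_lt k)), Real.exp_le_exp]
    nlinarith [mul_le_mul_of_nonneg_right hn (hα.pos n).le]
  obtain ⟨C, hC⟩ := (isBoundedUnder_of_eventually_le hev).bddAbove_range
  refine ⟨max C 0, le_max_right _ _, fun n => ?_⟩
  rw [← div_le_iff₀ (weight_pos hs k n)]
  exact (hC ⟨n, rfl⟩).trans (le_max_left _ _)

theorem bddAbove_of_isNuclearSpace (hα : IsExponentSeq α) (hs : IsBaseSeq s)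
    (h : IsNuclearSpace (CoEchelon α s)) :
    BddAbove (Set.range fun n : ℕ => Real.log (n + 1) / α n) := by
  by_contra hbdd
  set t : ℕ → ℝ := fun n => Real.log (n + 1) / α n with ht
  have ht0 : t 0 = 0 := by simp [ht]
  have hunb : ∀ B, ∃ n, B < t n := fun B => by
    by_contra! hB
    exact hbdd ⟨B, by rintro _ ⟨n, rfl⟩; exact hB n⟩
  have hT0 : ∀ n, 0 ≤ partialSups t n := fun n =>
    ht0 ▸ le_partialSups_of_le t (Nat.zero_le n)
  -- The running maximum makes the exponent monotone, and the half leaves the room that produces the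
  -- contradiction.
  have hT : Tendsto (fun n => partialSups t n / 2) atTop atTop := by
    refine Tendsto.atTop_div_const two_pos ?_
    refine tendsto_atTop_atTop_of_monotone (partialSups t).monotone fun B => ?_
    obtain ⟨n, hn⟩ := hunb B
    exact ⟨n, hn.le.trans (le_partialSups t n)⟩
  obtain ⟨K, hK⟩ := exists_sum_le_of_isNuclearSpace hα hs h (isDominated_exp hα hs hT)
  have hanti : Antitone fun n => Real.exp (-(partialSups t n / 2 * α n)) := by
    intro m n hmn
    have h1 : partialSups t m ≤ partialSups t n := (partialSups t).monotone hmn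
    have h2 := mul_le_mul h1 (hα.strictMono.monotone hmn) (hα.pos m).le (hT0 n)
    refine Real.exp_le_exp.2 ?_
    linarith
  have hN : ∀ n : ℕ, t n ≤ |Real.log K| / α 0 + partialSups t n / 2 := by
    intro n
    -- A decreasing weight with partial sums at most K satisfies (n+1)aₙ ≤ K; taking logarithms and
    -- dividing by αₙ ≥ α₀ gives the claim.
    have h1 : ((n : ℝ) + 1) * Real.exp (-(partialSups t n / 2 * α n)) ≤ K := by
      refine le_trans ?_ (hK (n + 1))
      have := Finset.card_nsmul_le_sum (Finset.range (n + 1))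
        (fun m => Real.exp (-(partialSups t m / 2 * α m))) _
        fun m hm => hanti (Nat.lt_succ_iff.1 (Finset.mem_range.1 hm))
      simpa using this
    have h2 := Real.log_le_log (by positivity) h1
    rw [Real.log_mul (by positivity) (Real.exp_pos _).ne', Real.log_exp] at h2
    have h3 : Real.log K / α n ≤ |Real.log K| / α 0 :=
      div_le_div₀ (abs_nonneg _) (le_abs_self _) (hα.pos 0)
        (hα.strictMono.monotone (Nat.zero_le n))
    have h4 : t n ≤ Real.log K / α n + partialSups t n / 2 := by
      rw [ht, div_add' _ _ _ (hα.pos n).ne']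
      exact div_le_div_of_nonneg_right (by linarith) (hα.pos n).le
    linarith
  obtain ⟨n, hn⟩ := hunb (2 * (|Real.log K| / α 0))
  -- At an index `m` where the running maximum is attained, `hN m` reads t m ≤ 2|log K|/α₀, while t
  -- m ≥ t n exceeds that bound.
  obtain ⟨m, hmn, hm⟩ := exists_partialSups_eq t n
  have h1 := hN m
  have h2 : partialSups t m ≤ t m := hm ▸ (partialSups t).monotone hmn
  have h3 : t n ≤ t m := hm ▸ le_partialSups t n
  linarith

end CoEchelon

/-! ### The inverse of the Cesàro operator -/

/-- The inverse of the Cesàro operator on the space of all sequences,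
`(D x)ₙ = (n + 1) xₙ - n xₙ₋₁`. -/
def cesaroInvSeq : (ℕ → ℂ) →ₗ[ℂ] (ℕ → ℂ) where
  -- At n = 0 the truncated index n - 1 is 0, but the coefficient n removes the term.
  toFun x n := (n + 1) * x n - n * x (n - 1)
  map_add' x y := by
    funext n
    simp only [Pi.add_apply]
    ring
  map_smul' c x := by
    funext n
    simp only [Pi.smul_apply, smul_eq_mul, RingHom.id_apply]
    ring

theorem cesaroSeq_cesaroInvSeq (x : ℕ → ℂ) : cesaroSeq (cesaroInvSeq x) = x := by
  have h : ∀ n : ℕ, ∑ i ∈ Finset.range (n + 1), cesaroInvSeq x i = (n + 1) * x n := by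
    intro n
    induction n with
    | zero => simp [cesaroInvSeq]
    | succ n ih =>
      rw [Finset.sum_range_succ, ih]
      simp [cesaroInvSeq]
  funext n
  change (∑ i ∈ Finset.range (n + 1), cesaroInvSeq x i) / (n + 1 : ℂ) = x n
  rw [h, mul_div_cancel_left₀ _ (Nat.cast_add_one_ne_zero n)]

theorem cesaroInvSeq_cesaroSeq (x : ℕ → ℂ) : cesaroInvSeq (cesaroSeq x) = x := by
  have h : ∀ n : ℕ, ((n : ℂ) + 1) * cesaroSeq x n = ∑ i ∈ Finset.range (n + 1), x i := fun n =>
    mul_div_cancel₀ _ (Nat.cast_add_one_ne_zero n)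
  funext n
  change ((n : ℂ) + 1) * cesaroSeq x n - n * cesaroSeq x (n - 1) = x n
  rw [h]
  cases n with
  | zero => simp
  | succ n =>
    rw [Nat.add_sub_cancel, Nat.cast_succ, h, Finset.sum_range_succ, add_sub_cancel_left]

theorem weight_mul_norm_cesaroInvSeq_le {α s : ℕ → ℝ} (hα : IsExponentSeq α) (hs : IsBaseSeq s)
    {k l : ℕ} (hl : ∀ n : ℕ, ((n : ℝ) + 1) * weight α s l n ≤ weight α s k n) (x : ℕ → ℂ)
    (n : ℕ) :
    weight α s l n * ‖cesaroInvSeq x n‖ ≤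
      weight α s k n * ‖x n‖ + weight α s k (n - 1) * ‖x (n - 1)‖ := by
  have h1 : ‖cesaroInvSeq x n‖ ≤ ((n : ℝ) + 1) * ‖x n‖ + n * ‖x (n - 1)‖ := by
    refine (norm_sub_le _ _).trans (le_of_eq ?_)
    rw [norm_mul, norm_mul, Complex.norm_natCast, ← Nat.cast_succ, Complex.norm_natCast,
      Nat.cast_succ]
  -- Since v_l decreases, n v_l(n) ≤ n v_l(n-1) ≤ v_k(n-1), which pairs the shifted entry with its
  -- own weight.
  have h2 : (n : ℝ) * weight α s l n ≤ weight α s k (n - 1) := by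
    cases n with
    | zero => simpa using (weight_pos hs k 0).le
    | succ n =>
      rw [Nat.add_sub_cancel, Nat.cast_succ]
      exact (mul_le_mul_of_nonneg_left (weight_antitone hα hs l n.le_succ)
        (by positivity)).trans (hl n)
  calc weight α s l n * ‖cesaroInvSeq x n‖
      ≤ weight α s l n * (((n : ℝ) + 1) * ‖x n‖ + n * ‖x (n - 1)‖) :=
        mul_le_mul_of_nonneg_left h1 (weight_pos hs l n).le
    _ = ((n : ℝ) + 1) * weight α s l n * ‖x n‖ + n * weight α s l n * ‖x (n - 1)‖ := by ring
    _ ≤ _ := add_le_add (mul_le_mul_of_nonneg_right (hl n) (norm_nonneg _))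
        (mul_le_mul_of_nonneg_right h2 (norm_nonneg _))

theorem cesaroInvSeq_mem_c0Submodule {α s : ℕ → ℝ} (hα : IsExponentSeq α) (hs : IsBaseSeq s)
    {k l : ℕ} (hl : ∀ n : ℕ, ((n : ℝ) + 1) * weight α s l n ≤ weight α s k n) {x : ℕ → ℂ}
    (hx : x ∈ c0Submodule (weight α s k)) : cesaroInvSeq x ∈ c0Submodule (weight α s l) := by
  have h0 := WeightedC0.tendsto_apply (weight_pos hs k) (⟨x, hx⟩ : c0Submodule (weight α s k))
  have h1 := h0.add (h0.comp (tendsto_sub_atTop_nat 1))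
  rw [add_zero] at h1
  refine squeeze_zero_norm (fun n => ?_) h1
  rw [norm_smul, Real.norm_of_nonneg (weight_pos hs l n).le]
  exact weight_mul_norm_cesaroInvSeq_le hα hs hl x n

theorem isUnit_cesaro {α s : ℕ → ℝ} (hα : IsExponentSeq α) (hs : IsBaseSeq s)
    (h : BddAbove (Set.range fun n : ℕ => Real.log (n + 1) / α n)) :
    IsUnit (cesaro hα hs) := by
  choose l hl using fun k => CoEchelon.exists_pow_mul_weight_le hα hs h 1 k
  simp only [pow_one] at hl
  have hmem : ∀ x ∈ coEchelonSubmodule α s, cesaroInvSeq x ∈ coEchelonSubmodule α s := by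
    have : coEchelonSubmodule α s ≤ (coEchelonSubmodule α s).comap cesaroInvSeq :=
      iSup_le fun k _ hy => Submodule.mem_iSup_of_mem (l k)
        (cesaroInvSeq_mem_c0Submodule hα hs (hl k) hy)
    exact fun x hx => this hx
  let D : CoEchelon α s →ₗ[ℂ] CoEchelon α s := cesaroInvSeq.restrict hmem
  have hD : Continuous D := by
    refine CoEchelon.continuous_of_comp_incl D fun k => ?_
    let S : WeightedC0 (weight α s k) →ₗ[ℂ] WeightedC0 (weight α s (l k)) :=
      cesaroInvSeq.restrict fun _ hx => cesaroInvSeq_mem_c0Submodule hα hs (hl k) hx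
    have hS : Continuous S := by
      refine AddMonoidHomClass.continuous_of_bound S 2 fun x => ?_
      refine WeightedC0.norm_le (weight_pos hs (l k)) _ fun n => ?_
      refine (weight_mul_norm_cesaroInvSeq_le hα hs (hl k) (WeightedC0.toSeq _ x) n).trans ?_
      rw [two_mul]
      exact add_le_add (WeightedC0.norm_apply_le (weight_pos hs k) x n)
        (WeightedC0.norm_apply_le (weight_pos hs k) x (n - 1))
    exact (CoEchelon.continuous_incl α s (l k)).comp hS
  refine isUnit_iff_exists.2 ⟨⟨D, hD⟩, ?_, ?_⟩
  · ext x
    exact CoEchelon.toSeq_injective (cesaroSeq_cesaroInvSeq _)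
  · ext x
    exact CoEchelon.toSeq_injective (cesaroInvSeq_cesaroSeq _)

/-- This is the test sequence against surjectivity: it is bounded and v_k → 0, yet its alternating
signs make (n+1)xₙ - n xₙ₋₁ grow linearly without cancellation. -/
theorem alternating_mem_c0Submodule {α s : ℕ → ℝ} (hα : IsExponentSeq α) (hs : IsBaseSeq s)
    (k : ℕ) : (fun n => (-1) ^ n : ℕ → ℂ) ∈ c0Submodule (weight α s k) := by
  have h : Tendsto (weight α s k) atTop (𝓝 0) := by
    have h1 := (Real.tendsto_exp_atBot.comp
      ((tendsto_neg_atTop_atBot.comp hα.tendsto).const_mul_atBot (Real.log_pos (hs.one_lt k))))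
    refine h1.congr fun n => ?_
    exact (Real.rpow_def_of_pos (zero_lt_one.trans (hs.one_lt k)) _).symm
  refine squeeze_zero_norm (fun n => ?_) h
  simp [abs_of_pos (weight_pos hs k n)]

theorem bddAbove_of_surjective_cesaro {α s : ℕ → ℝ} (hα : IsExponentSeq α) (hs : IsBaseSeq s)
    (h : Function.Surjective (cesaro hα hs)) :
    BddAbove (Set.range fun n : ℕ => Real.log (n + 1) / α n) := by
  obtain ⟨z, hz⟩ := h (CoEchelon.incl α s 0
    (⟨_, alternating_mem_c0Submodule hα hs 0⟩ : c0Submodule (weight α s 0)))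
  have hz' : cesaroSeq (CoEchelon.toSeq α s z) = fun n => (-1) ^ n :=
    congrArg (CoEchelon.toSeq α s) hz
  have hzn : ∀ n : ℕ, (n : ℝ) + 1 ≤ ‖CoEchelon.toSeq α s z n‖ := by
    intro n
    rw [← cesaroInvSeq_cesaroSeq (CoEchelon.toSeq α s z), hz']
    change (n : ℝ) + 1 ≤ ‖((n : ℂ) + 1) * (-1) ^ n - n * (-1) ^ (n - 1)‖
    cases n with
    | zero => simp
    | succ n =>
      have : (((n + 1 : ℕ) : ℂ) + 1) * (-1) ^ (n + 1) - (n + 1 : ℕ) * (-1) ^ (n + 1 - 1) =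
          ((2 * n + 3 : ℕ) : ℂ) * (-1) ^ (n + 1) := by
        rw [Nat.add_sub_cancel]
        push_cast
        ring
      rw [this, norm_mul, norm_pow, norm_neg, norm_one, one_pow, mul_one, Complex.norm_natCast]
      push_cast
      linarith [(Nat.cast_nonneg n : (0 : ℝ) ≤ n)]
  -- Membership of the preimage in one step gives (n+1) s_k^{-αₙ} ≤ ‖w‖; logarithms divided by αₙ ≥
  -- α₀ then yield a bound uniform in n.
  obtain ⟨k, w, rfl⟩ := CoEchelon.exists_incl_eq hα hs z
  refine ⟨|Real.log ‖w‖| / α 0 + Real.log (s k), ?_⟩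
  rintro _ ⟨n, rfl⟩
  have hsk : 0 < s k := zero_lt_one.trans (hs.one_lt k)
  have h1 : weight α s k n * ((n : ℝ) + 1) ≤ ‖w‖ :=
    (mul_le_mul_of_nonneg_left (hzn n) (weight_pos hs k n).le).trans
      (WeightedC0.norm_apply_le (weight_pos hs k) w n)
  have h2 := Real.log_le_log (mul_pos (weight_pos hs k n) (by positivity)) h1
  rw [Real.log_mul (weight_pos hs k n).ne' (by positivity), weight, Real.log_rpow hsk] at h2
  have h3 : Real.log ‖w‖ / α n ≤ |Real.log ‖w‖| / α 0 :=
    div_le_div₀ (abs_nonneg _) (le_abs_self _) (hα.pos 0)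
      (hα.strictMono.monotone (Nat.zero_le n))
  have h4 : Real.log (n + 1) / α n ≤ Real.log ‖w‖ / α n + Real.log (s k) := by
    rw [div_add' _ _ _ (hα.pos n).ne']
    exact div_le_div_of_nonneg_right (by linarith) (hα.pos n).le
  exact h4.trans (add_le_add_left h3 _)

end

theorem proposition2p4 (α s : ℕ → ℝ) (hα : IsExponentSeq α) (hs : IsBaseSeq s) :
    List.TFAE
      [IsNuclearSpace (CoEchelon α s),
        BddAbove (Set.range fun n : ℕ => Real.log (n + 1) / α n),
        (0 : ℂ) ∈ resolventSet ℂ (cesaro hα hs)] := by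
  have h3 : (0 : ℂ) ∈ resolventSet ℂ (cesaro hα hs) ↔ IsUnit (cesaro hα hs) := by
    rw [spectrum.mem_resolventSet_iff, map_zero, zero_sub, IsUnit.neg_iff]
  rw [h3]
  tfae_have 1 → 2 := CoEchelon.bddAbove_of_isNuclearSpace hα hs
  tfae_have 2 → 1 := CoEchelon.isNuclearSpace_of_bddAbove hα hs
  tfae_have 2 → 3 := isUnit_cesaro hα hs
  tfae_have 3 → 2 := fun h => by
    obtain ⟨D, hD, -⟩ := isUnit_iff_exists.1 h
    exact bddAbove_of_surjective_cesaro hα hs fun y => ⟨D y, DFunLike.congr_fun hD y⟩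
  tfae_finish
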